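/- Let $n\ge 2$, let $B_r\subset\mathbb R^n$ be the open ball of radius $r$ centred at the origin, let $0\le m<3$ and $\alpha>-\tfrac43 m$. Let $f:\mathbb R^n\times\mathbb R\to\mathbb R$ (for instance $f(x,t)=F(|x|,t)$), let $\mathfrak I\subset\mathbb R$ be an interval, and let $u\in C^0(B_1)$, with values in $\mathfrak I$, be a viscosity solution of $$\Delta_\infty u=f(x,u)\quad\text{in }B_1,\qquad \Delta_\infty u=\sum_{i,j}\partial_iu\,\partial_{ij}u\,\partial_ju;$$ that is, whenever $\varphi$ is $C^2$ near $x\in B_1$, one has $\Delta_\infty\varphi(x)\ge f(x,u(x))$ if $u-\varphi$ has a local maximum at $x$, and $\Delta_\infty\varphi(x)\le f(x,u(x))$ if $u-\varphi$ has a local minimum at $x$. (i) If there is a constant $K$ with $|f(rx,st)|\le K\,r^\alpha s^m$ for all $(x,t)\in B_1\times\mathfrak I$ and all $r,s\in(0,1)$, then $u$ is locally Lipschitz continuous in $B_1$. (ii) For every $\Lambda>0$ there is a constant $C_0>0$, depending only on $n,m,\alpha,\Lambda$, with the following property. Let $u$ be in addition non-negative, write $\partial\{u>0\}$ for the boundary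 of $\{u>0\}$ relative to $B_1$, and let $x_0\in\{u>0\}\cap B_{1/2}$ be a point for which there is a nearest free boundary point $\zeta\in\partial\{u>0\}$, that is, $|x_0-\zeta|=\operatorname{dist}(x_0,\partial\{u>0\})$, such that $$|f(x,t)|\le\Lambda\,|x-\zeta|^\alpha\,t_+^m\qquad\text{for all }x\in B_1\setminus\{\zeta\},\ t\in\mathfrak I$$ (with the convention $t_+^0=1$). Then $$|Du(x_0)|\le C_0\cdot\operatorname{dist}\big(x_0,\partial\{u>0\}\big)^{\frac{1+\alpha+m}{3-m}}.$$ Here $|Du(x_0)|$ is understood as the pointwise slope $\limsup_{x\to x_0}|u(x)-u(x_0)|/|x-x_0|$, which is the norm of the gradient wherever $u$ is differentiable. -/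

import Mathlib

open Set Filter Topology Metric

noncomputable section

/-- The infinity-Laplacian `Δ_∞ φ (x) = ⟨D²φ(x) Dφ(x), Dφ(x)⟩ = ∑ i j, ∂ᵢφ ∂ᵢⱼφ ∂ⱼφ`. -/
def infLaplacian {n : ℕ} (φ : EuclideanSpace ℝ (Fin n) → ℝ) (x : EuclideanSpace ℝ (Fin n)) : ℝ :=
  fderiv ℝ (fderiv ℝ φ) x (gradient φ x) (gradient φ x)

/-- `u` is a viscosity subsolution of `Δ_∞ u = f(x, u)` in `Ω`, i.e. `Δ_∞ u ≥ f(x, u)`.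
(Being a viscosity subsolution is a local property, so it is the same to test with functions that
are `C²` near the touching point or with functions that are `C²` on `Ω`.) -/
def IsViscositySubsolution {n : ℕ} (Ω : Set (EuclideanSpace ℝ (Fin n)))
    (f : EuclideanSpace ℝ (Fin n) → ℝ → ℝ) (u : EuclideanSpace ℝ (Fin n) → ℝ) : Prop :=
  ∀ (φ : EuclideanSpace ℝ (Fin n) → ℝ), ∀ x ∈ Ω, ContDiffAt ℝ 2 φ x →
    IsLocalMax (fun y => u y - φ y) x → f x (u x) ≤ infLaplacian φ x

/-- `u` is a viscosity supersolution of `Δ_∞ u = f(x, u)` in `Ω`, i.e. `Δ_∞ u ≤ f(x, u)`. -/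
def IsViscositySupersolution {n : ℕ} (Ω : Set (EuclideanSpace ℝ (Fin n)))
    (f : EuclideanSpace ℝ (Fin n) → ℝ → ℝ) (u : EuclideanSpace ℝ (Fin n) → ℝ) : Prop :=
  ∀ (φ : EuclideanSpace ℝ (Fin n) → ℝ), ∀ x ∈ Ω, ContDiffAt ℝ 2 φ x →
    IsLocalMin (fun y => u y - φ y) x → infLaplacian φ x ≤ f x (u x)

/-- `u ∈ C⁰(Ω)` is a viscosity solution of `Δ_∞ u = f(x, u)` in the open set `Ω`. -/
def IsViscositySolution {n : ℕ} (Ω : Set (EuclideanSpace ℝ (Fin n)))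
    (f : EuclideanSpace ℝ (Fin n) → ℝ → ℝ) (u : EuclideanSpace ℝ (Fin n) → ℝ) : Prop :=
  ContinuousOn u Ω ∧ IsViscositySubsolution Ω f u ∧ IsViscositySupersolution Ω f u

/-- The structural condition `|f(r x, s t)| ≤ K r^α s^m` for all `(x, t) ∈ B₁ × I` and all
`r, s ∈ (0, 1)`; the number `K` stands for the product `c_n ‖f₀‖_{L^∞(B₁)}`. -/
def HomogeneityBound {n : ℕ} (f : EuclideanSpace ℝ (Fin n) → ℝ → ℝ) (I : Set ℝ)
    (α m K : ℝ) : Prop :=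
  ∀ x ∈ ball (0 : EuclideanSpace ℝ (Fin n)) 1, ∀ t ∈ I, ∀ r ∈ Ioo (0 : ℝ) 1, ∀ s ∈ Ioo (0 : ℝ) 1,
    |f (r • x) (s * t)| ≤ K * r ^ α * s ^ m

/-- `|f(x, t)| ≤ Λ |x - ζ|^α t₊^m` for all `x ∈ B₁`, `x ≠ ζ`, and all `t ∈ I`. (The point `x = ζ`
is left out because the right-hand side is not meaningful there when `α < 0`.) -/
def GrowthBoundAt {n : ℕ} (f : EuclideanSpace ℝ (Fin n) → ℝ → ℝ) (I : Set ℝ)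
    (α m Λ : ℝ) (ζ : EuclideanSpace ℝ (Fin n)) : Prop :=
  ∀ x ∈ ball (0 : EuclideanSpace ℝ (Fin n)) 1, x ≠ ζ → ∀ t ∈ I,
    |f x t| ≤ Λ * ‖x - ζ‖ ^ α * (max t 0) ^ m

/-- The free boundary `∂{u > 0}` in `B₁` of a function `u` on `B₁`. -/
def freeBoundary {n : ℕ} (u : EuclideanSpace ℝ (Fin n) → ℝ) : Set (EuclideanSpace ℝ (Fin n)) :=
  frontier {x ∈ ball (0 : EuclideanSpace ℝ (Fin n)) 1 | 0 < u x} ∩ ball 0 1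

/-- The estimate `|Du(x₀)| ≤ L` for a function `u` that need not be differentiable at `x₀`: the
pointwise slope `limsup_{x → x₀} |u(x) - u(x₀)| / |x - x₀|` is at most `L`, and so is the norm of
the gradient if `u` is differentiable at `x₀`. -/
def GradientNormLE {n : ℕ} (u : EuclideanSpace ℝ (Fin n) → ℝ) (x₀ : EuclideanSpace ℝ (Fin n))
    (L : ℝ) : Prop :=
  (∀ ε > 0, ∀ᶠ x in 𝓝 x₀, |u x - u x₀| ≤ (L + ε) * ‖x - x₀‖) ∧
    (DifferentiableAt ℝ u x₀ → ‖gradient u x₀‖ ≤ L)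

end

/-! For a radial function `g ‖y - c‖` the operator reduces to `g'² g''`, so every estimate below is
a comparison with a one-variable barrier on a ball.

Part (i): a one-sided bound on `f y (u y)` near a point already suffices. A steep concave parabola
around a centre `c` bounds `u y - u c` by a multiple of `‖y - c‖`; as `c` is arbitrary, exchanging
the two points gives the Lipschitz bound.

Part (ii): put `β = (4 + α) / (3 - m)`, the exponent for which `d ^ β` balances `Δ_∞ u` against `d ^
α * u ^ m`. If `u c` exceeds a large multiple of `ρ ^ β`, a convex decreasing barrier forces `u`
above a cone on the ball of radius `ρ` about `c` (`exists_half_cone_le`). Such a cone cannot reach a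
zero of `u` on the boundary sphere, by a Hopf-type argument
(`IsViscositySupersolution.not_cone_le`). Hence `u ≤ C d ^ β` near `x₀`, where `d = ‖x₀ - ζ‖`
(`exists_growth_bounds`). The parabola estimate at scale `d` then bounds the slope by a multiple of
`d ^ (β - 1)`, and `β - 1 = (1 + α + m) / (3 - m)`. -/

/-! ### Radial functions and symmetries of the operator -/

/-- The infinity-Laplacian of the radial function `y ↦ g ‖y - c‖` is `g'² g''`. -/
theorem infLaplacian_radial {n : ℕ} {c x : EuclideanSpace ℝ (Fin n)} {g g' : ℝ → ℝ} {k : ℝ}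
    (hx : x ≠ c) (hg : ∀ᶠ t in 𝓝 ‖x - c‖, HasDerivAt g (g' t) t)
    (hg' : HasDerivAt g' k ‖x - c‖)
    (hC : ContDiffAt ℝ 2 (fun y => g ‖y - c‖) x) :
    infLaplacian (fun y => g ‖y - c‖) x = g' ‖x - c‖ ^ 2 * k := by
  set φ : EuclideanSpace ℝ (Fin n) → ℝ := fun y => g ‖y - c‖ with hφ
  have hv : x - c ≠ 0 := sub_ne_zero.2 hx
  have hpos : 0 < ‖x - c‖ := norm_pos_iff.2 hv
  have hcont : ContinuousAt (fun y : EuclideanSpace ℝ (Fin n) => ‖y - c‖) x := by fun_prop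
  have hfd : ∀ y : EuclideanSpace ℝ (Fin n), y ≠ c → HasDerivAt g (g' ‖y - c‖) ‖y - c‖ →
      HasFDerivAt φ ((g' ‖y - c‖ * ‖y - c‖⁻¹) • innerSL ℝ (y - c)) y := by
    intro y hy hgy
    have hyv : y - c ≠ 0 := sub_ne_zero.2 hy
    have hn : HasFDerivAt (fun y : EuclideanSpace ℝ (Fin n) => ‖y - c‖)
        (‖y - c‖⁻¹ • innerSL ℝ (y - c)) y := by
      have h1 : HasFDerivAt (fun y : EuclideanSpace ℝ (Fin n) => ‖y - c‖ ^ 2)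
          (2 • innerSL ℝ (y - c)) y := by
        have := (hasStrictFDerivAt_norm_sq (y - c)).hasFDerivAt.comp y
          ((hasFDerivAt_id y).sub_const c)
        rw [ContinuousLinearMap.comp_id] at this
        exact this
      have h2 := h1.sqrt (by positivity)
      have h3 : (fun y : EuclideanSpace ℝ (Fin n) => √(‖y - c‖ ^ 2)) = fun y => ‖y - c‖ := by
        funext z
        exact Real.sqrt_sq (norm_nonneg _)
      rw [h3] at h2
      refine h2.congr_fderiv ?_
      rw [Real.sqrt_sq (norm_nonneg _)]
      ext z
      simp
      ring
    have := hgy.comp_hasFDerivAt y hn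
    rw [smul_smul] at this
    exact this
  have hev : ∀ᶠ y in 𝓝 x, fderiv ℝ φ y = (g' ‖y - c‖ * ‖y - c‖⁻¹) • innerSL ℝ (y - c) := by
    filter_upwards [hcont.eventually hg, eventually_ne_nhds hx] with y hy hyc
    exact (hfd y hyc hy).fderiv
  set e := ‖x - c‖⁻¹ • (x - c) with he
  have hxe : x - c = ‖x - c‖ • e := by rw [he, smul_smul, mul_inv_cancel₀ hpos.ne', one_smul]
  have hen : ‖e‖ = 1 := norm_smul_inv_norm hv
  set l := g' ‖x - c‖ with hl
  have hgrad : gradient φ x = l • e := by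
    have : fderiv ℝ φ x = InnerProductSpace.toDual ℝ _ (l • e) := by
      rw [hev.self_of_nhds]
      ext z
      simp [he]
      ring
    rw [gradient, this, LinearIsometryEquiv.symm_apply_apply]
  -- Only the second derivative in the gradient direction is needed, and that direction is radial:
  -- along this line the problem is one-dimensional.
  have hline : HasDerivAt (fun s : ℝ => x + s • (l • e)) (l • e) 0 := by
    simpa using ((hasDerivAt_id (0 : ℝ)).smul_const (l • e)).const_add x
  have hdd : HasFDerivAt (fderiv ℝ φ) (fderiv ℝ (fderiv ℝ φ) x) x :=
    ((hC.fderiv_right (m := 1) (by norm_num)).differentiableAt (by norm_num)).hasFDerivAt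
  have h1 : HasDerivAt (fun s : ℝ => fderiv ℝ φ (x + s • (l • e)) (l • e))
      (fderiv ℝ (fderiv ℝ φ) x (l • e) (l • e)) 0 := by
    have h0 : HasFDerivAt (fderiv ℝ φ) (fderiv ℝ (fderiv ℝ φ) x) (x + (0 : ℝ) • (l • e)) := by
      simpa using hdd
    exact (ContinuousLinearMap.apply ℝ ℝ (l • e)).hasFDerivAt.comp_hasDerivAt 0
      (h0.comp_hasDerivAt 0 hline)
  have h2 : HasDerivAt (fun s : ℝ => g' (‖x - c‖ + s * l) * l) (k * l * l) 0 := by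
    have h0 : HasDerivAt g' k (‖x - c‖ + 0 * l) := by simpa using hg'
    have ha : HasDerivAt (fun s : ℝ => ‖x - c‖ + s * l) l 0 := by
      simpa using ((hasDerivAt_id (0 : ℝ)).mul_const l).const_add ‖x - c‖
    exact (h0.comp 0 ha).mul_const l
  have h3 : (fun s : ℝ => fderiv ℝ φ (x + s • (l • e)) (l • e)) =ᶠ[𝓝 0]
      fun s : ℝ => g' (‖x - c‖ + s * l) * l := by
    have hc1 : Tendsto (fun s : ℝ => x + s • (l • e)) (𝓝 0) (𝓝 x) := by
      simpa using hline.continuousAt.tendsto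
    have hc2 : ∀ᶠ s : ℝ in 𝓝 0, 0 < ‖x - c‖ + s * l := by
      have : ContinuousAt (fun s : ℝ => ‖x - c‖ + s * l) 0 := by fun_prop
      exact this.eventually (lt_mem_nhds (by simpa using hpos))
    filter_upwards [hc1.eventually hev, hc2] with s hs hs'
    have hy : x + s • (l • e) - c = (‖x - c‖ + s * l) • e := by
      rw [add_smul, ← hxe, smul_smul]
      abel
    have hyn : ‖x + s • (l • e) - c‖ = ‖x - c‖ + s * l := by
      rw [hy, norm_smul, hen, mul_one, Real.norm_of_nonneg hs'.le]
    rw [hs, hyn, hy]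
    simp only [_root_.smul_apply, innerSL_apply_apply, inner_smul_left,
      inner_smul_right, real_inner_self_eq_norm_sq, hen, smul_eq_mul]
    simp
    field_simp
  have h4 := h1.unique (h2.congr_of_eventuallyEq h3)
  rw [infLaplacian, hgrad, h4]
  ring

theorem infLaplacian_neg {n : ℕ} (φ : EuclideanSpace ℝ (Fin n) → ℝ)
    (x : EuclideanSpace ℝ (Fin n)) : infLaplacian (fun y => -φ y) x = -infLaplacian φ x := by
  have h1 : fderiv ℝ (fun y => -φ y) = fun y => -fderiv ℝ φ y := by
    funext y
    exact fderiv_fun_neg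
  have h2 : gradient (fun y => -φ y) x = -gradient φ x := by
    simp [gradient]
  rw [infLaplacian, infLaplacian, h1, h2, fderiv_fun_neg]
  simp

theorem infLaplacian_const {n : ℕ} (a : ℝ) (x : EuclideanSpace ℝ (Fin n)) :
    infLaplacian (fun _ => a) x = 0 := by
  simp [infLaplacian, gradient]

theorem IsViscositySupersolution.neg {n : ℕ} {Ω : Set (EuclideanSpace ℝ (Fin n))}
    {f : EuclideanSpace ℝ (Fin n) → ℝ → ℝ} {u : EuclideanSpace ℝ (Fin n) → ℝ}
    (hu : IsViscositySupersolution Ω f u) :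
    IsViscositySubsolution Ω (fun x t => -f x (-t)) (fun x => -u x) := by
  intro φ x hx hφ hmax
  have := hu (fun y => -φ y) x hx hφ.neg (by
    have := hmax.neg
    refine this.congr (Eventually.of_forall fun y => ?_)
    ring)
  rw [infLaplacian_neg] at this
  simp only [neg_neg]
  linarith

/-! ### Comparison with radial barriers -/

/-- Comparison of a subsolution with a strict radial supersolution on a punctured ball. -/
theorem IsViscositySubsolution.le_radial {n : ℕ} {Ω : Set (EuclideanSpace ℝ (Fin n))}
    {f : EuclideanSpace ℝ (Fin n) → ℝ → ℝ} {u : EuclideanSpace ℝ (Fin n) → ℝ}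
    (hu : IsViscositySubsolution Ω f u) {c : EuclideanSpace ℝ (Fin n)} {r : ℝ}
    (hΩ : closedBall c r ⊆ Ω) (hcont : ContinuousOn u (closedBall c r)) {g g' g'' : ℝ → ℝ}
    (hg : ContinuousOn g (Icc 0 r)) (hC : ∀ t ∈ Ioo 0 r, ContDiffAt ℝ 2 g t)
    (hg' : ∀ t ∈ Ioo 0 r, HasDerivAt g (g' t) t) (hg'' : ∀ t ∈ Ioo 0 r, HasDerivAt g' (g'' t) t)
    (h0 : u c ≤ g 0) (h1 : ∀ y, ‖y - c‖ = r → u y ≤ g r)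
    (hlt : ∀ y, ‖y - c‖ ∈ Ioo 0 r → g ‖y - c‖ < u y →
      g' ‖y - c‖ ^ 2 * g'' ‖y - c‖ < f y (u y)) :
    ∀ y ∈ closedBall c r, u y ≤ g ‖y - c‖ := by
  intro y hy
  have hw : ContinuousOn (fun y => u y - g ‖y - c‖) (closedBall c r) := by
    refine hcont.sub (hg.comp (by fun_prop) fun z hz => ?_)
    exact ⟨norm_nonneg _, by simpa [dist_eq_norm] using hz⟩
  -- If the claim fails, the maximum of `u - g` is positive, which excludes the centre and the
  -- sphere. Thus the strict inequality for `g` is needed only where `u` exceeds `g`.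
  obtain ⟨z, hz, hmax⟩ := (isCompact_closedBall c r).exists_isMaxOn ⟨y, hy⟩ hw
  by_contra! hlt'
  have hzpos : g ‖z - c‖ < u z := by
    have := hmax hy
    simp only [mem_ofPred_eq] at this
    linarith
  have hzr : ‖z - c‖ ≤ r := by simpa [dist_eq_norm] using hz
  have hzc : z ≠ c := by
    rintro rfl
    simp only [sub_self, norm_zero] at hzpos
    linarith
  have hzr' : ‖z - c‖ < r := by
    refine lt_of_le_of_ne hzr fun h => ?_
    have := h1 z h
    rw [h] at hzpos
    linarith
  have hmem : ‖z - c‖ ∈ Ioo 0 r := ⟨norm_pos_iff.2 (sub_ne_zero.2 hzc), hzr'⟩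
  have hnC : ContDiffAt ℝ 2 (fun y : EuclideanSpace ℝ (Fin n) => ‖y - c‖) z :=
    (contDiffAt_id.sub contDiffAt_const).norm ℝ (sub_ne_zero.2 hzc)
  have hφ : ContDiffAt ℝ 2 (fun y => g ‖y - c‖) z :=
    ContDiffAt.comp z (hC _ hmem) hnC
  have hloc : IsLocalMax (fun y => u y - g ‖y - c‖) z :=
    hmax.isLocalMax (closedBall_mem_nhds_of_mem (by simpa [dist_eq_norm] using hzr'))
  have h2 := hu _ z (hΩ hz) hφ hloc
  rw [infLaplacian_radial hzc (by
    filter_upwards [Ioo_mem_nhds hmem.1 hmem.2] with t ht using hg' t ht) (hg'' _ hmem) hφ] at h2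
  linarith [hlt z hmem hzpos]

/-- Comparison of a supersolution with a strict radial subsolution on a punctured ball. -/
theorem IsViscositySupersolution.radial_le {n : ℕ} {Ω : Set (EuclideanSpace ℝ (Fin n))}
    {f : EuclideanSpace ℝ (Fin n) → ℝ → ℝ} {u : EuclideanSpace ℝ (Fin n) → ℝ}
    (hu : IsViscositySupersolution Ω f u) {c : EuclideanSpace ℝ (Fin n)} {r : ℝ}
    (hΩ : closedBall c r ⊆ Ω) (hcont : ContinuousOn u (closedBall c r)) {g g' g'' : ℝ → ℝ}
    (hg : ContinuousOn g (Icc 0 r)) (hC : ∀ t ∈ Ioo 0 r, ContDiffAt ℝ 2 g t)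
    (hg' : ∀ t ∈ Ioo 0 r, HasDerivAt g (g' t) t) (hg'' : ∀ t ∈ Ioo 0 r, HasDerivAt g' (g'' t) t)
    (h0 : g 0 ≤ u c) (h1 : ∀ y, ‖y - c‖ = r → g r ≤ u y)
    (hlt : ∀ y, ‖y - c‖ ∈ Ioo 0 r → u y < g ‖y - c‖ →
      f y (u y) < g' ‖y - c‖ ^ 2 * g'' ‖y - c‖) :
    ∀ y ∈ closedBall c r, g ‖y - c‖ ≤ u y := by
  intro y hy
  have := hu.neg.le_radial hΩ hcont.neg (g := fun t => -g t) (g' := fun t => -g' t)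
    (g'' := fun t => -g'' t) hg.neg (fun t ht => (hC t ht).neg) (fun t ht => (hg' t ht).neg)
    (fun t ht => (hg'' t ht).neg) (neg_le_neg h0) (fun y hy => neg_le_neg (h1 y hy))
    (fun y hy hy' => by
      have := hlt y hy (neg_lt_neg_iff.1 hy')
      simp only [neg_neg, neg_sq]
      linarith) y hy
  exact neg_le_neg_iff.1 this

/-! ### Lipschitz estimates from one-sided bounds -/

/-- A subsolution of `Δ_∞ u ≥ -N` satisfies a one-sided Lipschitz estimate at the centre of a
ball. -/
theorem IsViscositySubsolution.sub_le_mul_norm {n : ℕ} {Ω : Set (EuclideanSpace ℝ (Fin n))}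
    {f : EuclideanSpace ℝ (Fin n) → ℝ → ℝ} {u : EuclideanSpace ℝ (Fin n) → ℝ}
    (hu : IsViscositySubsolution Ω f u) {c : EuclideanSpace ℝ (Fin n)} {r H : ℝ} (hr : 0 < r)
    (hH : 0 < H) (hΩ : closedBall c r ⊆ Ω) (hcont : ContinuousOn u (closedBall c r))
    (hosc : ∀ y ∈ closedBall c r, u y - u c ≤ 3 * H)
    (hf : ∀ y ∈ ball c r, -(8 * H ^ 3 / r ^ 4) < f y (u y)) :
    ∀ y ∈ closedBall c r, u y - u c ≤ 4 * H / r * ‖y - c‖ := by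
  intro y hy
  -- The parabola rises by exactly `3 * H` over the radius and its slope stays at least `2 * H / r`,
  -- so `g'² g'' ≤ -8 H³ / r⁴`.
  have h := hu.le_radial hΩ hcont (g := fun t => u c + (4 * H / r * t - H / r ^ 2 * t ^ 2))
    (g' := fun t => 4 * H / r - H / r ^ 2 * (2 * t)) (g'' := fun _ => -(H / r ^ 2 * 2))
    (by fun_prop) (fun t _ => by fun_prop)
    (fun t _ => by
      have h1 := ((hasDerivAt_id t).const_mul (4 * H / r)).sub
        (((hasDerivAt_id t).pow 2).const_mul (H / r ^ 2))
      have h2 := h1.const_add (u c)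
      exact h2.congr_deriv (by simp))
    (fun t _ => by
      have h1 := ((hasDerivAt_id t).const_mul 2).const_mul (H / r ^ 2)
      have h2 := h1.const_sub (4 * H / r)
      exact h2.congr_deriv (by simp))
    (by simp)
    (fun y hy => by
      have := hosc y (by simp [dist_eq_norm, hy])
      have h3 : 4 * H / r * r - H / r ^ 2 * r ^ 2 = 3 * H := by
        field_simp
        ring
      linarith)
    (fun y hy _ => by
      refine lt_of_le_of_lt ?_ (hf y (by simpa [dist_eq_norm] using hy.2))
      set t := ‖y - c‖
      have h1 : 2 * H / r ≤ 4 * H / r - H / r ^ 2 * (2 * t) := by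
        have : 4 * H / r - H / r ^ 2 * (2 * t) - 2 * H / r = 2 * H / r ^ 2 * (r - t) := by
          field_simp
          ring
        have h4 : 0 ≤ 2 * H / r ^ 2 * (r - t) := mul_nonneg (by positivity) (by linarith [hy.2])
        linarith
      have h2 : (2 * H / r) ^ 2 ≤ (4 * H / r - H / r ^ 2 * (2 * t)) ^ 2 :=
        pow_le_pow_left₀ (by positivity) h1 2
      have h3 := mul_le_mul_of_nonneg_right h2 (show 0 ≤ H / r ^ 2 * 2 by positivity)
      have h4 : (2 * H / r) ^ 2 * (H / r ^ 2 * 2) = 8 * H ^ 3 / r ^ 4 := by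
        field_simp
        ring
      linarith)
    y hy
  have h5 : 0 ≤ H / r ^ 2 * ‖y - c‖ ^ 2 := by positivity
  linarith

theorem IsViscositySupersolution.sub_le_mul_norm {n : ℕ} {Ω : Set (EuclideanSpace ℝ (Fin n))}
    {f : EuclideanSpace ℝ (Fin n) → ℝ → ℝ} {u : EuclideanSpace ℝ (Fin n) → ℝ}
    (hu : IsViscositySupersolution Ω f u) {c : EuclideanSpace ℝ (Fin n)} {r H : ℝ} (hr : 0 < r)
    (hH : 0 < H) (hΩ : closedBall c r ⊆ Ω) (hcont : ContinuousOn u (closedBall c r))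
    (hosc : ∀ y ∈ closedBall c r, u c - u y ≤ 3 * H)
    (hf : ∀ y ∈ ball c r, f y (u y) < 8 * H ^ 3 / r ^ 4) :
    ∀ y ∈ closedBall c r, u c - u y ≤ 4 * H / r * ‖y - c‖ := by
  intro y hy
  have := hu.neg.sub_le_mul_norm hr hH hΩ hcont.neg
    (fun y hy => by linarith [hosc y hy])
    (fun y hy => by
      simp only [neg_neg]
      linarith [hf y hy]) y hy
  linarith

/-- A continuous viscosity subsolution of `Δ_∞ u ≥ -K` near `x₀` is Lipschitz near `x₀`. -/
theorem IsViscositySubsolution.exists_lipschitzOnWith {n : ℕ}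
    {Ω : Set (EuclideanSpace ℝ (Fin n))}
    {f : EuclideanSpace ℝ (Fin n) → ℝ → ℝ} {u : EuclideanSpace ℝ (Fin n) → ℝ}
    (hu : IsViscositySubsolution Ω f u) (hΩ : IsOpen Ω) (hcont : ContinuousOn u Ω)
    {x₀ : EuclideanSpace ℝ (Fin n)} (hx₀ : x₀ ∈ Ω) {K : ℝ}
    (hf : ∀ᶠ y in 𝓝 x₀, -K ≤ f y (u y)) :
    ∃ L, ∃ t ∈ 𝓝 x₀, LipschitzOnWith L u t := by
  have hux : ContinuousAt u x₀ := hcont.continuousAt (hΩ.mem_nhds hx₀)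
  have hb : ∀ᶠ y in 𝓝 x₀, |u y - u x₀| < 1 := by
    have : ContinuousAt (fun y => |u y - u x₀|) x₀ := by fun_prop
    exact this.eventually (gt_mem_nhds (by simp))
  obtain ⟨R, hR, hball⟩ := Metric.eventually_nhds_iff_ball.1
    ((hf.and hb).and (hΩ.eventually_mem hx₀))
  set r := R / 4 with hr
  have hrpos : 0 < r := by positivity
  -- `H ≥ 1` dominates the oscillation, which is below `2`, and gives `H ≤ H ^ 3`, so that `H ^ 3 /
  -- r ^ 4` dominates `K`.
  set H : ℝ := max 1 (max K 1 * r ^ 4) with hH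
  have hHpos : 1 ≤ H := le_max_left _ _
  have hsub : ∀ c ∈ ball x₀ r, closedBall c r ⊆ ball x₀ R := by
    intro c hc y hy
    rw [mem_ball] at hc ⊢
    rw [mem_closedBall] at hy
    linarith [dist_triangle y c x₀]
  have key : ∀ c ∈ ball x₀ r, ∀ y ∈ closedBall c r, u y - u c ≤ 4 * H / r * ‖y - c‖ := by
    intro c hc
    refine hu.sub_le_mul_norm hrpos (by linarith) (fun y hy => (hball y (hsub c hc hy)).2)
      (hcont.mono fun y hy => (hball y (hsub c hc hy)).2) (fun y hy => ?_) (fun y hy => ?_)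
    · have h1 := (hball y (hsub c hc hy)).1.2
      have h2 := (hball c (hsub c hc (mem_closedBall_self hrpos.le))).1.2
      rw [abs_lt] at h1 h2
      linarith
    · have h1 := (hball y (hsub c hc (ball_subset_closedBall hy))).1.1
      have h2 : max K 1 * r ^ 4 ≤ H := le_max_right _ _
      have h3 : H ≤ H ^ 3 := le_self_pow₀ hHpos (by norm_num)
      have h4 : max K 1 ≤ H ^ 3 / r ^ 4 := by
        rw [le_div_iff₀ (by positivity)]
        linarith
      have h5 : K < 8 * H ^ 3 / r ^ 4 := by
        have := le_max_left K 1
        have := le_max_right K 1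
        have : 8 * H ^ 3 / r ^ 4 = 8 * (H ^ 3 / r ^ 4) := by ring
        linarith
      linarith
  refine ⟨Real.toNNReal (4 * H / r), ball x₀ (r / 2), ball_mem_nhds _ (by positivity),
    LipschitzOnWith.of_le_add_mul _ fun x hx y hy => ?_⟩
  rw [Real.coe_toNNReal _ (by positivity), dist_eq_norm]
  have h1 := key y (ball_subset_ball (by linarith) hy) x (by
    rw [mem_ball] at hx hy
    rw [mem_closedBall]
    linarith [dist_triangle_right x y x₀])
  linarith

theorem IsViscositySupersolution.exists_lipschitzOnWith {n : ℕ}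
    {Ω : Set (EuclideanSpace ℝ (Fin n))}
    {f : EuclideanSpace ℝ (Fin n) → ℝ → ℝ} {u : EuclideanSpace ℝ (Fin n) → ℝ}
    (hu : IsViscositySupersolution Ω f u) (hΩ : IsOpen Ω) (hcont : ContinuousOn u Ω)
    {x₀ : EuclideanSpace ℝ (Fin n)} (hx₀ : x₀ ∈ Ω) {K : ℝ}
    (hf : ∀ᶠ y in 𝓝 x₀, f y (u y) ≤ K) :
    ∃ L, ∃ t ∈ 𝓝 x₀, LipschitzOnWith L u t := by
  obtain ⟨L, t, ht, h⟩ := hu.neg.exists_lipschitzOnWith hΩ hcont.neg hx₀ (K := K) (by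
    filter_upwards [hf] with y hy
    simpa using hy)
  exact ⟨L, t, ht, fun x hx y hy => by simpa using h hx hy⟩

/-! ### Local Lipschitz continuity -/

theorem HomogeneityBound.abs_le {n : ℕ} {f : EuclideanSpace ℝ (Fin n) → ℝ → ℝ} {I : Set ℝ}
    {α m K : ℝ} (hf : HomogeneityBound f I α m K) (hm : 0 ≤ m)
    {y : EuclideanSpace ℝ (Fin n)} (hy : y ∈ ball 0 1) {s t : ℝ} (ht : t ∈ I)
    (hs : s ∈ Ioo (0 : ℝ) 1) : |f y (s * t)| ≤ |K| * 2 ^ |α| := by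
  have hy1 : ‖y‖ < 1 := by simpa using hy
  have hn := norm_nonneg y
  -- This dilation keeps `r⁻¹ • y` in the unit ball while `r ≥ 1 / 2`, so `r ^ α` is bounded for
  -- either sign of `α`, even at `y = 0`.
  set r := (1 + ‖y‖) / 2 with hr
  have hr0 : 1 / 2 ≤ r := by linarith
  have hr1 : r < 1 := by linarith
  have hrpos : 0 < r := by linarith
  have h := hf (r⁻¹ • y) (by
    rw [mem_ball_zero_iff, norm_smul, norm_inv, Real.norm_of_nonneg hrpos.le,
      inv_mul_lt_iff₀ hrpos]
    linarith) t ht r ⟨hrpos, hr1⟩ s hs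
  rw [smul_smul, mul_inv_cancel₀ hrpos.ne', one_smul] at h
  refine h.trans ?_
  have h1 : r ^ α ≤ 2 ^ |α| := by
    calc r ^ α ≤ r ^ (-|α|) :=
          Real.rpow_le_rpow_of_exponent_ge hrpos hr1.le (neg_abs_le α)
      _ = r⁻¹ ^ |α| := by rw [Real.rpow_neg hrpos.le, Real.inv_rpow hrpos.le]
      _ ≤ 2 ^ |α| := by
        refine Real.rpow_le_rpow (by positivity) ?_ (abs_nonneg _)
        rw [inv_le_comm₀ hrpos (by norm_num)]
        linarith
  have h2 : s ^ m ≤ 1 := Real.rpow_le_one hs.1.le hs.2.le hm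
  have h3 : 0 ≤ s ^ m := Real.rpow_nonneg hs.1.le _
  calc K * r ^ α * s ^ m ≤ |K| * 2 ^ |α| * s ^ m := by
        gcongr
        exact le_abs_self K
    _ ≤ |K| * 2 ^ |α| * 1 := by gcongr
    _ = _ := mul_one _

theorem locallyLipschitzOn_of_homogeneityBound {n : ℕ} {m α : ℝ} (hm : 0 ≤ m)
    {f : EuclideanSpace ℝ (Fin n) → ℝ → ℝ} {I : Set ℝ} {K : ℝ}
    {u : EuclideanSpace ℝ (Fin n) → ℝ} (hf : HomogeneityBound f I α m K)
    (hu : IsViscositySolution (ball 0 1) f u) (hI : MapsTo u (ball 0 1) I) :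
    LocallyLipschitzOn (ball 0 1) u := by
  obtain ⟨hcont, hsub, hsup⟩ := hu
  intro x₀ hx₀
  have hux : ContinuousAt u x₀ := hcont.continuousAt (isOpen_ball.mem_nhds hx₀)
  have hmem : ∀ᶠ y in 𝓝 x₀, y ∈ ball (0 : EuclideanSpace ℝ (Fin n)) 1 :=
    isOpen_ball.mem_nhds hx₀
  have hbd : ∀ y ∈ ball (0 : EuclideanSpace ℝ (Fin n)) 1, ∀ t ∈ I,
      (0 < u y ∧ u y < t) ∨ (u y < 0 ∧ t < u y) → |f y (u y)| ≤ |K| * 2 ^ |α| := by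
    intro y hy t ht h
    have ht0 : t ≠ 0 := by rcases h with h | h <;> [exact (h.1.trans h.2).ne'; exact (h.2.trans h.1).ne]
    have h1 := hf.abs_le hm hy ht (s := u y / t) (by
      rcases h with ⟨h1, h2⟩ | ⟨h1, h2⟩
      · exact ⟨div_pos h1 (h1.trans h2), (div_lt_one (h1.trans h2)).2 h2⟩
      · exact ⟨div_pos_of_neg_of_neg h1 (h2.trans h1), (div_lt_one_of_neg (h2.trans h1)).2 h2⟩)
    rwa [div_mul_cancel₀ _ ht0] at h1
  have hbd0 : ∀ y ∈ ball (0 : EuclideanSpace ℝ (Fin n)) 1, u y = 0 →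
      |f y (u y)| ≤ |K| * 2 ^ |α| := by
    intro y hy h
    have h1 := hf.abs_le hm hy (hI hy) (s := 1 / 2) (by norm_num)
    rw [h, mul_zero] at h1
    rwa [h]
  have hK : 0 ≤ |K| * 2 ^ |α| := by positivity
  have hlip : ∃ L, ∃ t ∈ 𝓝 x₀, LipschitzOnWith L u t := by
    -- The homogeneity bound controls `f y (u y)` only if `u y` is zero or lies strictly between
    -- zero and an element of `I`. At an extreme value of `I` a constant test function supplies a
    -- sign instead: `f ≥ 0` at a minimum, `f ≤ 0` at a maximum. Hence the lower bound is used when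
    -- `u x₀ ≤ 0` and the upper one when `u x₀ > 0`.
    rcases le_or_gt (u x₀) 0 with h0 | h0
    · refine hsub.exists_lipschitzOnWith isOpen_ball hcont hx₀ (K := |K| * 2 ^ |α|) ?_
      have hpos : ∀ᶠ y in 𝓝 x₀, 0 < u y → ∃ t ∈ I, u y < t := by
        by_cases hex : ∃ t ∈ I, 0 < t
        · obtain ⟨t, ht, ht0⟩ := hex
          filter_upwards [hux.eventually (gt_mem_nhds (h0.trans_lt ht0))] with y hy _
          exact ⟨t, ht, hy⟩
        · filter_upwards [hmem] with y hy hy0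
          exact absurd ⟨u y, hI hy, hy0⟩ hex
      filter_upwards [hmem, hpos] with y hy hypos
      rcases lt_trichotomy (u y) 0 with h | h | h
      · by_cases hex : ∃ t ∈ I, t < u y
        · obtain ⟨t, ht, htu⟩ := hex
          exact (abs_le.1 (hbd y hy t ht (.inr ⟨h, htu⟩))).1
        · push Not at hex
          have h2 := hsup (fun _ => u y) y hy contDiffAt_const (by
            filter_upwards [isOpen_ball.mem_nhds hy] with z hz
            simpa using hex _ (hI hz))
          rw [infLaplacian_const] at h2
          linarith
      · exact (abs_le.1 (hbd0 y hy h)).1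
      · obtain ⟨t, ht, htu⟩ := hypos h
        exact (abs_le.1 (hbd y hy t ht (.inl ⟨h, htu⟩))).1
    · refine hsup.exists_lipschitzOnWith isOpen_ball hcont hx₀ (K := |K| * 2 ^ |α|) ?_
      filter_upwards [hmem, hux.eventually (lt_mem_nhds h0)] with y hy h
      by_cases hex : ∃ t ∈ I, u y < t
      · obtain ⟨t, ht, htu⟩ := hex
        exact (abs_le.1 (hbd y hy t ht (.inl ⟨h, htu⟩))).2
      · push Not at hex
        have h2 := hsub (fun _ => u y) y hy contDiffAt_const (by
          filter_upwards [isOpen_ball.mem_nhds hy] with z hz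
          simpa using hex _ (hI hz))
        rw [infLaplacian_const] at h2
        linarith
  obtain ⟨L, t, ht, h⟩ := hlip
  exact ⟨L, t, mem_nhdsWithin_of_mem_nhds ht, h⟩

/-! ### Cone barriers and the Hopf-type argument -/

/-- This fixes the natural scaling: dividing by `A ^ m` leaves `P * ρ ^ (4 + α) < A ^ (3 - m)`,
whose root gives the threshold for `A`. -/
theorem exists_mul_rpow_lt_cube (α : ℝ) {m : ℝ} (hm : m < 3) {P : ℝ} (hP : 0 < P) :
    ∃ C : ℝ, 0 < C ∧ ∀ ρ A : ℝ, 0 < ρ → C * ρ ^ ((4 + α) / (3 - m)) < A →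
      P * ρ ^ (4 + α) * A ^ m < A ^ 3 := by
  have h3 : 0 < 3 - m := by linarith
  refine ⟨P ^ (1 / (3 - m)), by positivity, fun ρ A hρ hA => ?_⟩
  have hA0 : 0 < A := lt_trans (by positivity) hA
  have h1 : (P ^ (1 / (3 - m)) * ρ ^ ((4 + α) / (3 - m))) ^ (3 - m) < A ^ (3 - m) :=
    Real.rpow_lt_rpow (by positivity) hA h3
  rw [Real.mul_rpow (by positivity) (by positivity), ← Real.rpow_mul hP.le,
    ← Real.rpow_mul hρ.le, div_mul_cancel₀ _ h3.ne', div_mul_cancel₀ _ h3.ne',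
    Real.rpow_one] at h1
  have h2 : A ^ 3 = A ^ (3 - m) * A ^ m := by
    rw [← Real.rpow_add hA0, sub_add_cancel]
    exact_mod_cast (Real.rpow_natCast A 3).symm
  rw [h2]
  gcongr

/-- For `α ≥ 0` the upper bound on `D` decides; for `α < 0` the lower one does, at the price of a
factor singular as `s → 0`. -/
theorem rpow_le_of_mul_le_of_le_mul {α M ρ s D : ℝ} (hM : 1 ≤ M) (hρ : 0 < ρ) (hs : 0 < s)
    (h1 : ρ * s ≤ D) (h2 : D ≤ M * ρ) :
    D ^ α ≤ M ^ |α| * ρ ^ α * s ^ min α 0 := by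
  have hD : 0 < D := lt_of_lt_of_le (by positivity) h1
  rcases le_total 0 α with h | h
  · rw [abs_of_nonneg h, min_eq_right h, Real.rpow_zero, mul_one,
      ← Real.mul_rpow (by positivity) hρ.le]
    exact Real.rpow_le_rpow hD.le h2 h
  · rw [min_eq_left h]
    calc D ^ α ≤ (ρ * s) ^ α := Real.rpow_le_rpow_of_nonpos (by positivity) h1 h
      _ = 1 * ρ ^ α * s ^ α := by rw [Real.mul_rpow hρ.le hs.le, one_mul]
      _ ≤ _ := by
        gcongr
        exact Real.one_le_rpow hM (abs_nonneg _)

/-- If a non-negative supersolution is large at the centre of a ball, compared with the natural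
scaling, then it lies above a cone in that ball. -/
theorem exists_half_cone_le {m α Λ M : ℝ} (hm₀ : 0 ≤ m) (hm₃ : m < 3) (hα : -1 < m + min α 0)
    (hΛ : 0 < Λ) (hM : 0 ≤ M) :
    ∃ C : ℝ, 0 < C ∧ ∀ (n : ℕ) (Ω : Set (EuclideanSpace ℝ (Fin n)))
      (f : EuclideanSpace ℝ (Fin n) → ℝ → ℝ)
      (u : EuclideanSpace ℝ (Fin n) → ℝ) (ζ : EuclideanSpace ℝ (Fin n)),
      IsViscositySupersolution Ω f u → ContinuousOn u Ω → (∀ x ∈ Ω, 0 ≤ u x) →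
      (∀ x ∈ Ω, x ≠ ζ → |f x (u x)| ≤ Λ * ‖x - ζ‖ ^ α * u x ^ m) →
      ∀ (c : EuclideanSpace ℝ (Fin n)) (ρ : ℝ), 0 < ρ → closedBall c ρ ⊆ Ω → ρ ≤ ‖c - ζ‖ →
        ‖c - ζ‖ ≤ M * ρ → C * ρ ^ ((4 + α) / (3 - m)) < u c →
        ∀ y ∈ closedBall c ρ, u c / 2 * (1 - ‖y - c‖ / ρ) ≤ u y := by
  -- Near the sphere the right-hand side can blow up like `s ^ (m + min α 0)`, where `s = 1 - t /
  -- ρ`. The barrier term `s ^ (1 + θ)` has second derivative of order `s ^ (θ - 1)`, which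
  -- dominates since `θ - 1 ≤ m + min α 0`.
  set θ := min 1 (1 + (m + min α 0)) with hθ
  have hθ0 : 0 < θ := lt_min one_pos (by linarith)
  have hθ1 : θ ≤ 1 + (m + min α 0) := min_le_right _ _
  set Q := Λ * (M + 1) ^ |α| with hQ
  have hQ0 : 0 < Q := by positivity
  obtain ⟨C, hC, hCA⟩ := exists_mul_rpow_lt_cube α hm₃
    (P := Q * 8 / ((1 + θ) * θ)) (by positivity)
  refine ⟨C, hC, fun n Ω f u ζ hu hcont hnn hf c ρ hρ hΩ hcζ hcM hA => ?_⟩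
  set A := u c with hAdef
  have hA0 : 0 < A := lt_trans (by positivity) hA
  have hs : ∀ t ∈ Ioo 0 ρ, 0 < 1 - t / ρ := fun t ht => by
    rw [sub_pos, div_lt_one hρ]
    exact ht.2
  have hds : ∀ t, HasDerivAt (fun t : ℝ => 1 - t / ρ) (-(1 / ρ)) t := fun t =>
    ((hasDerivAt_id t).div_const ρ).const_sub 1
  have hcomp := hu.radial_le hΩ (hcont.mono hΩ)
    (g := fun t => A / 2 * ((1 - t / ρ) + (1 - t / ρ) ^ (1 + θ)))
    (g' := fun t => -(A / (2 * ρ)) * (1 + (1 + θ) * (1 - t / ρ) ^ θ))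
    (g'' := fun t => A / (2 * ρ ^ 2) * ((1 + θ) * θ) * (1 - t / ρ) ^ (θ - 1))
    (by
      refine continuousOn_const.mul (ContinuousOn.add (by fun_prop) ?_)
      exact ContinuousOn.rpow_const (by fun_prop) fun _ _ => .inr (by linarith))
    (fun t ht => by
      have := (hs t ht).ne'
      have h1 : ContDiffAt ℝ 2 (fun t : ℝ => 1 - t / ρ) t := by fun_prop
      exact contDiffAt_const.mul (h1.add (h1.rpow_const_of_ne this)))
    (fun t ht => by
      have h1 := ((hds t).add ((hds t).rpow_const (p := 1 + θ) (.inl (hs t ht).ne'))).const_mul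
        (A / 2)
      refine h1.congr_deriv ?_
      rw [add_sub_cancel_left]
      field_simp
      ring)
    (fun t ht => by
      have h1 := ((((hds t).rpow_const (p := θ) (.inl (hs t ht).ne')).const_mul
        (1 + θ)).const_add 1).const_mul (-(A / (2 * ρ)))
      refine h1.congr_deriv ?_
      field_simp)
    (by simp only [zero_div, sub_zero, Real.one_rpow]; linarith)
    (fun y hy => by
      simp only [div_self hρ.ne', sub_self, Real.zero_rpow (by linarith : 1 + θ ≠ 0), add_zero,
        mul_zero]
      exact hnn y (hΩ (by simp [dist_eq_norm, hy])))
    (fun y hy hlt => by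
      have hyΩ : y ∈ Ω := hΩ (by simpa [dist_eq_norm] using hy.2.le)
      have hs0 := hs _ hy
      set t := ‖y - c‖ with ht
      set s := 1 - t / ρ with hsdef
      have hts : t = ρ * (1 - s) := by
        rw [hsdef]
        field_simp
        ring
      have hs1 : s ≤ 1 := by
        have : 0 ≤ t / ρ := div_nonneg hy.1.le hρ.le
        linarith
      have htri : ‖c - ζ‖ ≤ t + ‖y - ζ‖ := by
        rw [ht, norm_sub_rev y c]
        exact norm_sub_le_norm_sub_add_norm_sub c y ζ
      have htri' : ‖y - ζ‖ ≤ t + ‖c - ζ‖ := norm_sub_le_norm_sub_add_norm_sub y c ζ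
      have hD1 : ρ * s ≤ ‖y - ζ‖ := by
        rw [hts] at htri
        linarith
      have hD2 : ‖y - ζ‖ ≤ (M + 1) * ρ := by linarith [hy.2]
      have hyζ : y ≠ ζ := by
        rintro rfl
        simp only [sub_self, norm_zero] at hD1
        exact absurd hD1 (not_le.2 (by positivity))
      have hu0 := hnn y hyΩ
      -- Comparison is only tested where `u` is below the barrier, so the barrier itself bounds `u ^
      -- m`.
      have huA : u y ≤ A * s := by
        have h1 : s ^ (1 + θ) ≤ s := by
          simpa using Real.rpow_le_rpow_of_exponent_ge hs0 hs1 (show 1 ≤ 1 + θ by linarith)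
        have h2 : A / 2 * (s + s ^ (1 + θ)) ≤ A / 2 * (s + s) := by gcongr
        linarith
      have hfle : f y (u y) ≤ Q * ρ ^ α * A ^ m * s ^ (θ - 1) := by
        calc f y (u y) ≤ Λ * ‖y - ζ‖ ^ α * u y ^ m := (le_abs_self _).trans (hf y hyΩ hyζ)
          _ ≤ Λ * ((M + 1) ^ |α| * ρ ^ α * s ^ min α 0) * (A * s) ^ m := by
            gcongr
            exact rpow_le_of_mul_le_of_le_mul (by linarith) hρ hs0 hD1 hD2
          _ = Q * ρ ^ α * A ^ m * s ^ (m + min α 0) := by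
            rw [Real.mul_rpow hA0.le hs0.le, Real.rpow_add hs0]
            ring
          _ ≤ Q * ρ ^ α * A ^ m * s ^ (θ - 1) := by
            refine mul_le_mul_of_nonneg_left ?_ (by positivity)
            exact Real.rpow_le_rpow_of_exponent_ge hs0 hs1 (by linarith)
      have hkey : Q * ρ ^ α * A ^ m < (A / (2 * ρ)) ^ 2 * (A / (2 * ρ ^ 2) * ((1 + θ) * θ)) := by
        have h1 := hCA ρ A hρ hA
        have h2 : ρ ^ (4 + α) = ρ ^ 4 * ρ ^ α := by
          rw [Real.rpow_add hρ]
          exact_mod_cast congrArg (· * ρ ^ α) (Real.rpow_natCast ρ 4)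
        rw [h2] at h1
        have h3 : Q * ρ ^ α * A ^ m = Q * 8 / ((1 + θ) * θ) * (ρ ^ 4 * ρ ^ α) * A ^ m *
            ((1 + θ) * θ / (8 * ρ ^ 4)) := by
          field_simp
        have h4 : (A / (2 * ρ)) ^ 2 * (A / (2 * ρ ^ 2) * ((1 + θ) * θ)) =
            A ^ 3 * ((1 + θ) * θ / (8 * ρ ^ 4)) := by
          field_simp
          ring
        rw [h3, h4]
        exact mul_lt_mul_of_pos_right h1 (by positivity)
      have hsq : (A / (2 * ρ)) ^ 2 ≤ (-(A / (2 * ρ)) * (1 + (1 + θ) * s ^ θ)) ^ 2 := by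
        rw [mul_pow, neg_sq]
        refine le_mul_of_one_le_right (by positivity) (one_le_pow₀ ?_)
        have : 0 ≤ (1 + θ) * s ^ θ := by positivity
        linarith
      have hsp : 0 < s ^ (θ - 1) := Real.rpow_pos_of_pos hs0 _
      calc f y (u y) ≤ Q * ρ ^ α * A ^ m * s ^ (θ - 1) := hfle
        _ < (A / (2 * ρ)) ^ 2 * (A / (2 * ρ ^ 2) * ((1 + θ) * θ)) * s ^ (θ - 1) :=
          mul_lt_mul_of_pos_right hkey hsp
        _ ≤ (-(A / (2 * ρ)) * (1 + (1 + θ) * s ^ θ)) ^ 2 *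
            (A / (2 * ρ ^ 2) * ((1 + θ) * θ)) * s ^ (θ - 1) := by gcongr
        _ = _ := by ring)
  intro y hy
  refine le_trans ?_ (hcomp y hy)
  have hs0 : 0 ≤ 1 - ‖y - c‖ / ρ := by
    rw [sub_nonneg, div_le_one hρ]
    simpa [dist_eq_norm] using hy
  have : 0 ≤ A / 2 * (1 - ‖y - c‖ / ρ) ^ (1 + θ) := by positivity
  linarith

/-- A non-negative supersolution cannot lie above a cone in a ball that has a zero of the
supersolution on its boundary. -/
theorem IsViscositySupersolution.not_cone_le {n : ℕ} {Ω : Set (EuclideanSpace ℝ (Fin n))}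
    {f : EuclideanSpace ℝ (Fin n) → ℝ → ℝ} {u : EuclideanSpace ℝ (Fin n) → ℝ}
    (hu : IsViscositySupersolution Ω f u) (hΩ : IsOpen Ω) (hnn : ∀ x ∈ Ω, 0 ≤ u x)
    {c ζ : EuclideanSpace ℝ (Fin n)} (hζ : ζ ∈ Ω) (huζ : u ζ = 0) (hcζ : c ≠ ζ)
    {a : ℝ} (ha : 0 < a) :
    ¬ ∀ y ∈ closedBall c ‖c - ζ‖, a * (‖c - ζ‖ - ‖y - c‖) ≤ u y := by
  intro hcone
  set ρ := ‖c - ζ‖ with hρdef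
  have hρ : 0 < ρ := norm_pos_iff.2 (sub_ne_zero.2 hcζ)
  have hζρ : ‖ζ - c‖ = ρ := norm_sub_rev _ _
  set q := a / 2 with hq
  have hq0 : 0 < q := by positivity
  -- The test function has slope `q = a / 2`, half that of the cone, leaving room for any quadratic
  -- term near `ζ`. Then `B` is taken so large that its infinity-Laplacian `2 * B * q ^ 2` exceeds
  -- the finite number `f ζ (u ζ)`.
  set B := (|f ζ (u ζ)| + 1) / q ^ 2 with hB
  have hB0 : 0 < B := by positivity
  have hnC : ContDiffAt ℝ 2 (fun y : EuclideanSpace ℝ (Fin n) => ‖y - c‖) ζ :=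
    (contDiffAt_id.sub contDiffAt_const).norm ℝ (sub_ne_zero.2 hcζ.symm)
  have hφ : ContDiffAt ℝ 2 (fun y : EuclideanSpace ℝ (Fin n) =>
      (fun t : ℝ => q * (ρ - t) + B * (ρ - t) ^ 2) ‖y - c‖) ζ := by
    fun_prop
  have hmin : IsLocalMin (fun y => u y - (fun t : ℝ => q * (ρ - t) + B * (ρ - t) ^ 2) ‖y - c‖)
      ζ := by
    have hsmall : ∀ᶠ y in 𝓝 ζ, |ρ - ‖y - c‖| * B < q := by
      have : ContinuousAt (fun y => |ρ - ‖y - c‖| * B) ζ := by fun_prop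
      exact this.eventually (gt_mem_nhds (by simpa [hζρ] using hq0))
    filter_upwards [hsmall, hΩ.mem_nhds hζ] with y hy hyΩ
    simp only [hζρ, huζ, sub_self]
    have h0 := hnn y hyΩ
    rcases le_total ‖y - c‖ ρ with h | h
    · have h1 := hcone y (by simpa [dist_eq_norm] using h)
      rw [abs_of_nonneg (by linarith)] at hy
      have h2 : (ρ - ‖y - c‖) * ((ρ - ‖y - c‖) * B) ≤ (ρ - ‖y - c‖) * q :=
        mul_le_mul_of_nonneg_left hy.le (by linarith)
      have h3 : a = 2 * q := by rw [hq]; ring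
      rw [h3] at h1
      nlinarith
    · rw [abs_of_nonpos (by linarith)] at hy
      have h2 : (‖y - c‖ - ρ) * (-(ρ - ‖y - c‖) * B) ≤ (‖y - c‖ - ρ) * q :=
        mul_le_mul_of_nonneg_left hy.le (by linarith)
      nlinarith
  have hd : ∀ t : ℝ, HasDerivAt (fun t : ℝ => ρ - t) (-1) t := fun t =>
    (hasDerivAt_id t).const_sub ρ
  have h1 := hu _ ζ hζ hφ hmin
  have hlap := infLaplacian_radial (g' := fun t => -q - 2 * B * (ρ - t)) (k := 2 * B) hcζ.symm
    (Eventually.of_forall fun t => by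
      refine (((hd t).const_mul q).add (((hd t).pow 2).const_mul B)).congr_deriv ?_
      simp
      ring)
    (by
      refine (((hd _).const_mul (2 * B)).const_sub (-q)).congr_deriv ?_
      simp) hφ
  replace h1 := hlap.symm.trans_le h1
  rw [hζρ] at h1
  have h2 : (-q - 2 * B * (ρ - ρ)) ^ 2 * (2 * B) = 2 * (|f ζ (u ζ)| + 1) := by
    rw [hB]
    field_simp
    ring
  rw [h2] at h1
  linarith [le_abs_self (f ζ (u ζ)), abs_nonneg (f ζ (u ζ))]

/-! ### Growth away from a zero -/

/-- Bounds for non-negative solutions with a zero `ζ`, with the natural scaling in the distance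
to `ζ`. -/
theorem exists_growth_bounds {m α Λ : ℝ} (hm₀ : 0 ≤ m) (hm₃ : m < 3) (hα : -1 < m + min α 0)
    (hβ : 0 ≤ (4 + α) / (3 - m)) (hΛ : 0 < Λ) :
    ∃ C : ℝ, 0 < C ∧ ∀ (n : ℕ) (f : EuclideanSpace ℝ (Fin n) → ℝ → ℝ)
      (u : EuclideanSpace ℝ (Fin n) → ℝ) (ζ : EuclideanSpace ℝ (Fin n)),
      IsViscositySupersolution (ball 0 1) f u → ContinuousOn u (ball 0 1) →
      (∀ x ∈ ball (0 : EuclideanSpace ℝ (Fin n)) 1, 0 ≤ u x) →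
      (∀ x ∈ ball (0 : EuclideanSpace ℝ (Fin n)) 1, x ≠ ζ →
        |f x (u x)| ≤ Λ * ‖x - ζ‖ ^ α * u x ^ m) →
      ζ ∈ ball (0 : EuclideanSpace ℝ (Fin n)) 1 → u ζ = 0 →
      ∀ x₀ ∈ ball (0 : EuclideanSpace ℝ (Fin n)) (1 / 2), x₀ ≠ ζ →
        ∀ y ∈ closedBall x₀ (‖x₀ - ζ‖ / 16), u y ≤ C * ‖x₀ - ζ‖ ^ ((4 + α) / (3 - m)) := by
  obtain ⟨C, hC, hcone⟩ := exists_half_cone_le hm₀ hm₃ hα hΛ (M := 20) (by norm_num)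
  set β := (4 + α) / (3 - m) with hβdef
  refine ⟨C + 5 * (31 * C * 2 ^ β), by positivity,
    fun n f u ζ hu hcont hnn hf hζ huζ x₀ hx₀ hne => ?_⟩
  have hcone' := hcone n (ball 0 1) f u ζ hu hcont hnn hf
  have hsubset : ∀ (c : EuclideanSpace ℝ (Fin n)) (ρ : ℝ), ‖c‖ + ρ < 1 →
      closedBall c ρ ⊆ ball 0 1 := fun c ρ h =>
    closedBall_subset_ball' (by rwa [dist_zero_right, add_comm])
  -- A Harnack-type step: at distance at most `4 / 7 * ρ` the half cone retains `3 / 14` of `u c`,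
  -- and `14 / 3 ≤ 5`.
  have hchain : ∀ (c : EuclideanSpace ℝ (Fin n)) (ρ : ℝ), 0 < ρ → ‖c‖ + ρ < 1 →
      ρ ≤ ‖c - ζ‖ → ‖c - ζ‖ ≤ 20 * ρ → ∀ y, ‖y - c‖ ≤ 4 / 7 * ρ →
      u c ≤ C * ρ ^ β + 5 * u y := by
    intro c ρ hρ hc h1 h2 y hy
    have hyc : y ∈ closedBall c ρ := by
      rw [mem_closedBall, dist_eq_norm]
      linarith
    have hy0 := hnn y (hsubset c ρ hc hyc)
    have hC0 : 0 ≤ C * ρ ^ β := by positivity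
    rcases le_or_gt (u c) (C * ρ ^ β) with h | h
    · linarith
    · have h3 := hcone' c ρ hρ (hsubset c ρ hc) h1 h2 h y hyc
      have h4 : ‖y - c‖ / ρ ≤ 4 / 7 := (div_le_iff₀ hρ).2 hy
      have h5 : u c / 2 * (3 / 7) ≤ u c / 2 * (1 - ‖y - c‖ / ρ) :=
        mul_le_mul_of_nonneg_left (by linarith) (by linarith)
      linarith
  have hzero : ∀ c : EuclideanSpace ℝ (Fin n), ‖c‖ + ‖c - ζ‖ < 1 →
      u c ≤ C * ‖c - ζ‖ ^ β := by
    intro c hc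
    rcases eq_or_ne c ζ with rfl | hcζ
    · rw [huζ]
      positivity
    · by_contra! h
      have hpos : 0 < ‖c - ζ‖ := norm_pos_iff.2 (sub_ne_zero.2 hcζ)
      have huc : 0 < u c := lt_trans (by positivity) h
      refine hu.not_cone_le isOpen_ball hnn hζ huζ hcζ (a := u c / 2 / ‖c - ζ‖) (by positivity)
        fun y hy => ?_
      have h3 := hcone' c _ hpos (hsubset c _ hc) le_rfl (by linarith) h y hy
      refine le_of_eq_of_le ?_ h3
      field_simp
  rw [mem_ball_zero_iff] at hx₀ hζ
  set d := ‖x₀ - ζ‖ with hd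
  have hd0 : 0 < d := norm_pos_iff.2 (sub_ne_zero.2 hne)
  have hd1 : d < 3 / 2 := (norm_sub_le x₀ ζ).trans_lt (by linarith)
  have hcenter : u x₀ ≤ 31 * C * 2 ^ β * d ^ β := by
    have h2β : (1 : ℝ) ≤ 2 ^ β := Real.one_le_rpow (by norm_num) hβ
    rcases lt_or_ge d (1 / 2) with hlt | hge
    · calc u x₀ ≤ C * d ^ β := hzero x₀ (by linarith)
        _ = 1 * C * 1 * d ^ β := by ring
        _ ≤ 31 * C * 2 ^ β * d ^ β := by gcongr; norm_num
    · have hone : ∀ ρ : ℝ, 0 ≤ ρ → ρ ≤ 1 → C * ρ ^ β ≤ C := fun ρ h0 h1 =>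
        mul_le_of_le_one_right hC.le (Real.rpow_le_one h0 h1 hβ)
      -- The ball about `x₀` reaching `ζ` may leave the unit ball, so the bound is carried along
      -- `x₀`, `x₀ / 2`, `0`; the ball about `0` reaching `ζ` does fit. Steps have length below `1 /
      -- 4 = 4 / 7 * (7 / 16)`. Two steps give `C + 5 * (C + 5 * C) = 31 * C`.
      set z := (1 / 2 : ℝ) • x₀ with hz
      have hzn : ‖z‖ = ‖x₀‖ / 2 := by
        rw [hz, norm_smul]
        norm_num
        ring
      have hzx : ‖z - x₀‖ = ‖x₀‖ / 2 := by
        rw [show z - x₀ = -z by rw [hz]; module, norm_neg, hzn]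
      have h1 := hchain x₀ (7 / 16) (by norm_num) (by linarith) (by linarith) (by linarith) z
        (by linarith)
      have h2 := hone (7 / 16) (by norm_num) (by norm_num)
      have hzb : u z ≤ 6 * C := by
        rcases lt_or_ge ‖z - ζ‖ (7 / 16) with hzlt | hzge
        · have h3 := hzero z (by linarith)
          have h4 := hone _ (norm_nonneg (z - ζ)) (by linarith)
          linarith
        · have h6 := norm_sub_le z ζ
          have h3 := hchain z (7 / 16) (by norm_num) (by linarith) hzge (by linarith) 0
            (by rw [zero_sub, norm_neg]; linarith)
          have h4 := hzero 0 (by simpa using hζ)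
          have h5 := hone _ (norm_nonneg (0 - ζ)) (by simpa using hζ.le)
          linarith
      -- Here `d` is bounded below, so a constant bound already has the form `d ^ β`.
      have h3 : 1 ≤ (2 * d) ^ β := Real.one_le_rpow (by linarith) hβ
      rw [Real.mul_rpow (by norm_num) hd0.le] at h3
      have h4 : 31 * C * 1 ≤ 31 * C * (2 ^ β * d ^ β) := by gcongr
      linarith
  intro y hy
  have hyd : ‖y - x₀‖ ≤ d / 16 := by simpa [dist_eq_norm] using hy
  have t1 : ‖y‖ ≤ ‖y - x₀‖ + ‖x₀‖ := norm_le_norm_sub_add y x₀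
  have t2 : ‖y - ζ‖ ≤ ‖y - x₀‖ + d := norm_sub_le_norm_sub_add_norm_sub y x₀ ζ
  have t3 : d ≤ ‖y - x₀‖ + ‖y - ζ‖ := by
    rw [norm_sub_rev y x₀]
    exact norm_sub_le_norm_sub_add_norm_sub x₀ y ζ
  have h1 := hchain y (d / 8) (by positivity) (by linarith) (by linarith) (by linarith) x₀
    (by rw [norm_sub_rev]; linarith)
  have h2 : C * (d / 8) ^ β ≤ C * d ^ β := by
    gcongr
    linarith
  linarith

/-! ### The gradient estimate -/

theorem GradientNormLE.of_forall_closedBall {n : ℕ} {u : EuclideanSpace ℝ (Fin n) → ℝ}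
    {x₀ : EuclideanSpace ℝ (Fin n)} {L r : ℝ} (hL : 0 ≤ L) (hr : 0 < r)
    (h : ∀ y ∈ closedBall x₀ r, |u y - u x₀| ≤ L * ‖y - x₀‖) : GradientNormLE u x₀ L := by
  have hev : ∀ᶠ y in 𝓝 x₀, |u y - u x₀| ≤ L * ‖y - x₀‖ := by
    filter_upwards [closedBall_mem_nhds x₀ hr] with y hy using h y hy
  refine ⟨fun ε hε => ?_, fun hd => ?_⟩
  · filter_upwards [hev] with y hy
    refine hy.trans ?_
    gcongr
    linarith
  · rw [gradient, LinearIsometryEquiv.norm_map]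
    exact hd.hasFDerivAt.le_of_lip' hL hev

theorem exists_gradientNormLE {m α Λ : ℝ} (hm₀ : 0 ≤ m) (hm₃ : m < 3) (hα : -1 < m + min α 0)
    (hβ : 0 ≤ (4 + α) / (3 - m)) (hΛ : 0 < Λ) :
    ∃ C₀ : ℝ, 0 < C₀ ∧ ∀ (n : ℕ) (f : EuclideanSpace ℝ (Fin n) → ℝ → ℝ)
      (u : EuclideanSpace ℝ (Fin n) → ℝ) (ζ : EuclideanSpace ℝ (Fin n)),
      IsViscositySolution (ball 0 1) f u →
      (∀ x ∈ ball (0 : EuclideanSpace ℝ (Fin n)) 1, 0 ≤ u x) →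
      (∀ x ∈ ball (0 : EuclideanSpace ℝ (Fin n)) 1, x ≠ ζ →
        |f x (u x)| ≤ Λ * ‖x - ζ‖ ^ α * u x ^ m) →
      ζ ∈ ball (0 : EuclideanSpace ℝ (Fin n)) 1 → u ζ = 0 →
      ∀ x₀ ∈ ball (0 : EuclideanSpace ℝ (Fin n)) (1 / 2), x₀ ≠ ζ →
        GradientNormLE u x₀ (C₀ * ‖x₀ - ζ‖ ^ ((1 + α + m) / (3 - m))) := by
  obtain ⟨C, hC, hgrowth⟩ := exists_growth_bounds hm₀ hm₃ hα hβ hΛ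
  obtain ⟨P, hP, hPA⟩ := exists_mul_rpow_lt_cube α hm₃ (P := Λ * 2 ^ |α|) (by positivity)
  set β := (4 + α) / (3 - m) with hβdef
  refine ⟨64 * (C + P), by positivity, fun n f u ζ hu hnn hf hζ huζ x₀ hx₀ hne => ?_⟩
  obtain ⟨hcont, hsub, hsup⟩ := hu
  have hb := hgrowth n f u ζ hsup hcont hnn hf hζ huζ x₀ hx₀ hne
  rw [mem_ball_zero_iff] at hx₀ hζ
  set d := ‖x₀ - ζ‖ with hd
  have hd0 : 0 < d := norm_pos_iff.2 (sub_ne_zero.2 hne)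
  have hd1 : d < 3 / 2 := (norm_sub_le x₀ ζ).trans_lt (by linarith)
  set r := d / 16 with hr
  have hr0 : 0 < r := by positivity
  have hdβ : 0 < d ^ β := by positivity
  -- The part with `C` dominates `u` on the small ball, the part with `P` makes `H ^ 3 / d ^ 4`
  -- dominate `f`. The slope `4 * H / r` with `r = d / 16` yields the factor `64`.
  set H := (C + P) * d ^ β with hH
  have hH0 : 0 < H := by positivity
  have hball : closedBall x₀ r ⊆ ball 0 1 :=
    closedBall_subset_ball' (by rw [dist_zero_right]; linarith)
  have huH : ∀ y ∈ closedBall x₀ r, u y ≤ H := fun y hy => by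
    have h1 : 0 < P * d ^ β := by positivity
    have h2 : H = C * d ^ β + P * d ^ β := add_mul _ _ _
    linarith [hb y hy]
  have hfH : ∀ y ∈ ball x₀ r, |f y (u y)| < 8 * H ^ 3 / r ^ 4 := by
    intro y hy
    have hyb := ball_subset_closedBall hy
    have hyd : ‖y - x₀‖ < r := by simpa [dist_eq_norm] using hy
    have t2 : ‖y - ζ‖ ≤ ‖y - x₀‖ + d := norm_sub_le_norm_sub_add_norm_sub y x₀ ζ
    have t3 : d ≤ ‖y - x₀‖ + ‖y - ζ‖ := by
      rw [norm_sub_rev y x₀]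
      exact norm_sub_le_norm_sub_add_norm_sub x₀ y ζ
    have hyζ : y ≠ ζ := by
      rintro rfl
      simp only [sub_self, norm_zero] at t3
      linarith
    have hu0 := hnn y (hball hyb)
    have hrpow : ‖y - ζ‖ ^ α ≤ 2 ^ |α| * d ^ α := by
      have hD : 0 < ‖y - ζ‖ := by linarith
      have hq : ‖y - ζ‖ / d ≤ 2 := by
        rw [div_le_iff₀ hd0]
        linarith
      have hq' : 2⁻¹ ≤ ‖y - ζ‖ / d := by
        rw [le_div_iff₀ hd0]
        linarith
      rw [← div_le_iff₀ (by positivity), ← Real.div_rpow hD.le hd0.le]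
      rcases le_total 0 α with h | h
      · rw [abs_of_nonneg h]
        exact Real.rpow_le_rpow (by positivity) hq h
      · rw [abs_of_nonpos h, Real.rpow_neg (by norm_num), ← Real.inv_rpow (by norm_num)]
        exact Real.rpow_le_rpow_of_nonpos (by norm_num) hq' h
    have h1 := hPA d H hd0 (by
      rw [hH, add_mul]
      have : 0 < C * d ^ β := by positivity
      linarith)
    have h2 : d ^ (4 + α) = d ^ 4 * d ^ α := by
      rw [Real.rpow_add hd0]
      exact_mod_cast congrArg (· * d ^ α) (Real.rpow_natCast d 4)
    rw [h2] at h1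
    calc |f y (u y)| ≤ Λ * ‖y - ζ‖ ^ α * u y ^ m := hf y (hball hyb) hyζ
      _ ≤ Λ * (2 ^ |α| * d ^ α) * H ^ m := by
        gcongr
        exact huH y hyb
      _ = Λ * 2 ^ |α| * (d ^ 4 * d ^ α) * H ^ m / d ^ 4 := by
        field_simp
      _ < H ^ 3 / d ^ 4 := by gcongr
      _ ≤ 8 * H ^ 3 / r ^ 4 := by
        gcongr
        · linarith [pow_pos hH0 3]
        · linarith
  have hx₀r : x₀ ∈ closedBall x₀ r := mem_closedBall_self hr0.le
  have hL : 64 * (C + P) * d ^ ((1 + α + m) / (3 - m)) = 4 * H / r := by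
    have h3 : 3 - m ≠ 0 := by linarith
    have : (1 + α + m) / (3 - m) = β - 1 := by
      rw [hβdef]
      field_simp
      ring
    rw [this, Real.rpow_sub_one hd0.ne', hH, hr]
    field_simp
    ring
  rw [hL]
  refine GradientNormLE.of_forall_closedBall (by positivity) hr0 fun y hy => abs_le.2 ?_
  have h1 := hsub.sub_le_mul_norm hr0 hH0 hball (hcont.mono hball)
    (fun y hy => by linarith [huH y hy, hnn x₀ (hball hx₀r)])
    (fun y hy => (abs_lt.1 (hfH y hy)).1) y hy
  have h2 := hsup.sub_le_mul_norm hr0 hH0 hball (hcont.mono hball)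
    (fun y hy => by linarith [huH x₀ hx₀r, hnn y (hball hy)])
    (fun y hy => (abs_lt.1 (hfH y hy)).2) y hy
  constructor <;> linarith

theorem eq_zero_of_mem_freeBoundary {n : ℕ} {u : EuclideanSpace ℝ (Fin n) → ℝ}
    (hcont : ContinuousOn u (ball 0 1))
    (hnn : ∀ x ∈ ball (0 : EuclideanSpace ℝ (Fin n)) 1, 0 ≤ u x)
    {ζ : EuclideanSpace ℝ (Fin n)} (hζ : ζ ∈ freeBoundary u) : u ζ = 0 := by
  refine le_antisymm (not_lt.1 fun h => hζ.1.2 ?_) (hnn ζ hζ.2)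
  rw [mem_interior_iff_mem_nhds]
  have hc : ContinuousAt u ζ := hcont.continuousAt (isOpen_ball.mem_nhds hζ.2)
  filter_upwards [isOpen_ball.mem_nhds hζ.2, hc.eventually (lt_mem_nhds h)] with y hy hy'
  exact ⟨hy, hy'⟩

theorem corollary1p1 (n : ℕ) (hn : 2 ≤ n) (m α : ℝ) (hm₀ : 0 ≤ m) (hm₃ : m < 3)
    (hα : -(4 / 3) * m < α) :
    -- local Lipschitz continuity
    (∀ (f : EuclideanSpace ℝ (Fin n) → ℝ → ℝ) (I : Set ℝ) (K : ℝ)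
        (u : EuclideanSpace ℝ (Fin n) → ℝ),
      I.OrdConnected → HomogeneityBound f I α m K →
      IsViscositySolution (ball 0 1) f u → MapsTo u (ball 0 1) I →
      LocallyLipschitzOn (ball 0 1) u) ∧
    -- gradient growth
    (∀ Λ : ℝ, 0 < Λ → ∃ C₀ : ℝ, 0 < C₀ ∧
      ∀ (f : EuclideanSpace ℝ (Fin n) → ℝ → ℝ) (I : Set ℝ) (u : EuclideanSpace ℝ (Fin n) → ℝ),
        I.OrdConnected → IsViscositySolution (ball 0 1) f u → MapsTo u (ball 0 1) I →
        (∀ x ∈ ball (0 : EuclideanSpace ℝ (Fin n)) 1, 0 ≤ u x) →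
        ∀ x₀ ∈ ball (0 : EuclideanSpace ℝ (Fin n)) (1 / 2), 0 < u x₀ →
        ∀ ζ ∈ freeBoundary u, ‖x₀ - ζ‖ = infDist x₀ (freeBoundary u) →
        GrowthBoundAt f I α m Λ ζ →
        GradientNormLE u x₀
          (C₀ * infDist x₀ (freeBoundary u) ^ ((1 + α + m) / (3 - m)))) := by
  have h3m : 0 < 3 - m := by linarith
  -- For `α < 0` the hypothesis gives `m + α > -m / 3 > -1`; it also gives `4 + α > 0`. Both use `m
  -- < 3`.
  have hα' : -1 < m + min α 0 := by
    rcases min_cases α 0 with h | h <;> linarith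
  have hβ : 0 ≤ (4 + α) / (3 - m) := div_nonneg (by linarith) h3m.le
  refine ⟨fun f I K u _ hf hu hI => locallyLipschitzOn_of_homogeneityBound hm₀ hf hu hI,
    fun Λ hΛ => ?_⟩
  obtain ⟨C₀, hC₀, h⟩ := exists_gradientNormLE hm₀ hm₃ hα' hβ hΛ
  refine ⟨C₀, hC₀, fun f I u _ hu hI hnn x₀ hx₀ hux₀ ζ hζ hdist hf => ?_⟩
  have huζ := eq_zero_of_mem_freeBoundary hu.1 hnn hζ
  rw [← hdist]
  refine h n f u ζ hu hnn (fun x hx hxζ => ?_) hζ.2 huζ x₀ hx₀ ?_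
  · simpa only [max_eq_left (hnn x hx)] using hf x hx hxζ (u x) (hI hx)
  · rintro rfl
    exact hux₀.ne' huζ
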